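/- \textbf{Setting.} Temporal Datalog has a sort of objects and a sort of time points $\mathbb N$, with countably many variables of each sort. An object term is a constant or an object variable; a time term is a natural number or an expression $T+k$ with $T$ a time variable and $k\in\mathbb Z$ ($T$ itself is $T+0$). Rigid predicates take object terms only; temporal predicates take in addition one time term, as last argument. A rule has the form $\bigwedge_i\beta_i\to\beta$ with $\beta_i,\beta$ atoms, and is safe: each variable of $\beta$ occurs in some $\beta_i$. A program is a set of safe rules. A predicate is intensional (IDB) if it occurs in the head of a rule of the program with non-empty body, and extensional (EDB) otherwise. A fact is a ground atom. A query is a pair $Q=\langle P,\Pi\rangle$ with $\Pi$ a program and $P$ an IDB atom. A data stream $D$ is a set of EDB facts, and $D_\tau$ is the set of its facts with temporal argument at most $\tau$ (so $D_{-1}=\emptyset$). Substitutions map variables to terms of the same sort and have finite support $\mathrm{supp}\,\theta=\{X\mid\theta(X)\neq X\}$; additions of time constants are computed, and an application of a substitution that would produce a negative time constant is undefined. The composition $\theta\sigma$ maps $X$ to $(X\theta)\sigma$, and $\theta|_S$ is the restriction to a set $S$ of variables (the identity outside $S$). A substitution is ground if it maps each variable in its support to a constant. A set $I$ of facts is a model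 of a set of rules if, for each (defined) ground instance of a rule, the head is in $I$ whenever all body atoms are; $\Gamma\models\alpha$ means that $\alpha$ belongs to all models of $\Gamma$. A \emph{hypothetical answer} to $Q$ over $D_\tau$ is a pair $\langle\theta,H\rangle$ where $\theta$ is a ground substitution with $\mathrm{supp}\,\theta=\mathrm{var}(P)$ and $H$ is a finite set of ground EDB temporal atoms, all with time stamp greater than $\tau$, such that $P\theta$ is defined, $\Pi\cup D_\tau\cup H\models P\theta$, and $H$ is minimal with respect to inclusion among such sets for this $\theta$. A finite SLD-derivation of $\Gamma\cup\{\neg P\}$ is a sequence of goals $G_0=\neg P,G_1,\dots,G_n$ with variants $C_1,\dots,C_n$ of clauses of $\Gamma$ and substitutions $\theta_1,\dots,\theta_n$, where $C_{i+1}$ shares no variable with $G_i$, $\theta_{i+1}$ is a most general unifier of the head of $C_{i+1}$ and some atom $\beta$ of $G_i$ such that all variables in the terms of its bindings occur in $\beta$, and $G_{i+1}$ results from $G_i$ by replacing $\beta$ with the body of $C_{i+1}$ and applying $\theta_{i+1}$. A \emph{future atom} with respect to $\tau$ is an atom of a temporal predicate whose time term contains a variable or is a time point greater than $\tau$. A \emph{computed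 answer with premises} to $Q$ over $D_\tau$ is a pair $\langle\rho,\bigwedge_i\alpha_i\rangle$ such that some finite SLD-derivation of $\Pi\cup D_\tau\cup\{\neg P\}$ has last goal $\neg\bigwedge_i\alpha_i$, all $\alpha_i$ are future EDB atoms with respect to $\tau$, and $\rho=(\theta_1\cdots\theta_n)|_{\mathrm{var}(P)}$, where the composition $\theta_1\cdots\theta_n$ is defined. \textbf{Proposition (Completeness).} Let $Q=\langle P,\Pi\rangle$ be a query, $D$ a data stream and $\tau$ a time instant (any integer; the value $-1$ is included). If $\langle\theta,H\rangle$ is a hypothetical answer to $Q$ over $D_\tau$, then there exist substitutions $\rho$ and $\sigma$ and finitely many atoms $\alpha_i$ such that $\theta=(\rho\sigma)|_{\mathrm{var}(P)}$, $H=\{\alpha_i\sigma\}_i$ (with $\rho\sigma$ and all $\alpha_i\sigma$ defined), and $\langle\rho,\bigwedge_i\alpha_i\rangle$ is a computed answer with premises to $Q$ over $D_\tau$. -/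

import Mathlib

namespace TemporalDatalog

universe u v w

/-- A vocabulary of Temporal Datalog: object constants, rigid predicate symbols (object parameters
only) and temporal predicate symbols (object parameters followed by one temporal parameter).
`rigidArity` and `temporalArity` count the object parameters. Variables of either sort are indexed
by natural numbers, and the temporal constants are the natural numbers. -/
structure Vocabulary where
  Obj : Type u
  RigidPred : Type v
  TemporalPred : Type w
  rigidArity : RigidPred → ℕ
  temporalArity : TemporalPred → ℕ

/-- Variables, of object sort or of temporal sort. -/
inductive Var where
  | obj (i : ℕ) : Var
  | time (i : ℕ) : Var

/-- Object terms: constants and object variables. -/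
inductive ObjTerm (V : Vocabulary.{u, v, w}) where
  | const (c : V.Obj) : ObjTerm V
  | var (i : ℕ) : ObjTerm V

/-- Time terms: `point n` is the temporal constant `n`, and `add i k` is `T_i + k` with `k` an
integer; the time variable `T_i` itself is `add i 0`. -/
inductive TimeTerm where
  | point (n : ℕ) : TimeTerm
  | add (i : ℕ) (k : ℤ) : TimeTerm

/-- The time variable with index `i`. -/
def TimeTerm.var (i : ℕ) : TimeTerm := .add i 0

variable {V : Vocabulary.{u, v, w}}

/-- The variables of an object term. -/
def ObjTerm.vars : ObjTerm V → Set Var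
  | .const _ => ∅
  | .var i => {Var.obj i}

/-- The variables of a time term. -/
def TimeTerm.vars : TimeTerm → Set Var
  | .point _ => ∅
  | .add i _ => {Var.time i}

/-- Atoms: a predicate symbol applied to terms of the expected sorts. -/
inductive Atom (V : Vocabulary.{u, v, w}) where
  | rigid (p : V.RigidPred) (args : Fin (V.rigidArity p) → ObjTerm V) : Atom V
  | temporal (p : V.TemporalPred) (args : Fin (V.temporalArity p) → ObjTerm V)
      (t : TimeTerm) : Atom V

/-- The predicate symbol of an atom. -/
def Atom.pred : Atom V → V.RigidPred ⊕ V.TemporalPred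
  | .rigid p _ => Sum.inl p
  | .temporal p _ _ => Sum.inr p

/-- The variables of an atom. -/
def Atom.vars : Atom V → Set Var
  | .rigid _ args => ⋃ j, (args j).vars
  | .temporal _ args t => (⋃ j, (args j).vars) ∪ t.vars

/-- An atom is ground if it contains no variables. As time terms are kept in evaluated form, the
ground atoms are exactly the facts. -/
def Atom.IsGround (a : Atom V) : Prop := a.vars = ∅

/-- The variables of a conjunction of atoms. -/
def conjVars (G : List (Atom V)) : Set Var := {x | ∃ a ∈ G, x ∈ a.vars}

/-- Rules `⋀ body → head`. -/
structure Rule (V : Vocabulary.{u, v, w}) where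
  body : List (Atom V)
  head : Atom V

/-- The variables of a rule. -/
def Rule.vars (r : Rule V) : Set Var := conjVars r.body ∪ r.head.vars

/-- A rule is safe if each variable of its head occurs in its body. -/
def Rule.IsSafe (r : Rule V) : Prop := r.head.vars ⊆ conjVars r.body

/-- A fact, as a rule with empty body. -/
def Rule.ofFact (a : Atom V) : Rule V := ⟨[], a⟩

/-! ### Substitutions -/

/-- Substitutions: maps from variables to terms of the same sort, with finite support. -/
structure Subst (V : Vocabulary.{u, v, w}) where
  obj : ℕ → ObjTerm V
  time : ℕ → TimeTerm
  finite_obj : {i | obj i ≠ .var i}.Finite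
  finite_time : {i | time i ≠ .var i}.Finite

namespace Subst

/-- The identity (empty) substitution. -/
def id : Subst V where
  obj := .var
  time := .var
  finite_obj := by simp
  finite_time := by simp

/-- The support of a substitution. -/
def supp (θ : Subst V) : Set Var :=
  {x | match x with
    | .obj i => θ.obj i ≠ .var i
    | .time i => θ.time i ≠ .var i}

/-- The variables that occur in the image of a variable. -/
def varsAt (θ : Subst V) : Var → Set Var
  | .obj i => (θ.obj i).vars
  | .time i => (θ.time i).vars

/-- A substitution is ground if it maps every variable of its support to a constant. -/
def IsGround (θ : Subst V) : Prop := ∀ x ∈ θ.supp, θ.varsAt x = ∅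

open Classical in
/-- The restriction of a substitution to a set of variables (the identity elsewhere). -/
noncomputable def restrict (θ : Subst V) (S : Set Var) : Subst V where
  obj i := if Var.obj i ∈ S then θ.obj i else .var i
  time i := if Var.time i ∈ S then θ.time i else .var i
  finite_obj := θ.finite_obj.subset fun i hi => by
    by_cases h : Var.obj i ∈ S <;> simp_all
  finite_time := θ.finite_time.subset fun i hi => by
    by_cases h : Var.time i ∈ S <;> simp_all

end Subst

/-- Application of a substitution to an object term. -/
def ObjTerm.subst (θ : Subst V) : ObjTerm V → ObjTerm V
  | .const c => .const c
  | .var i => θ.obj i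

/-- Addition of an integer to a time term. The result is undefined if it would be a negative
number, since temporal constants are natural numbers. -/
def TimeTerm.addInt : TimeTerm → ℤ → Option TimeTerm
  | .point n, k => if 0 ≤ (n : ℤ) + k then some (.point ((n : ℤ) + k).toNat) else none
  | .add i j, k => some (.add i (j + k))

/-- Application of a substitution to a time term, with additions of temporal constants computed;
undefined if a negative number would result. -/
def TimeTerm.subst (θ : Subst V) : TimeTerm → Option TimeTerm
  | .point n => some (.point n)
  | .add i k => (θ.time i).addInt k

/-- Application of a substitution to an atom; undefined if its time term becomes negative. -/
def Atom.subst (θ : Subst V) : Atom V → Option (Atom V)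
  | .rigid p args => some (.rigid p fun j => (args j).subst θ)
  | .temporal p args t => (t.subst θ).map (Atom.temporal p fun j => (args j).subst θ)

/-- Application of a substitution to a conjunction; defined if it is on every conjunct. -/
def conjSubst (θ : Subst V) (G : List (Atom V)) : Option (List (Atom V)) :=
  G.mapM (Atom.subst θ)

/-- `κ` is the composition `θσ` (first `θ`, then `σ`): it maps each variable `X` to `(Xθ)σ`, which
has to be defined. -/
def Subst.IsComp (θ σ κ : Subst V) : Prop :=
  (∀ i, (θ.obj i).subst σ = κ.obj i) ∧ (∀ i, (θ.time i).subst σ = some (κ.time i))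

/-- `κ` is the composition `θ₁θ₂⋯θₙ` of a list of substitutions. -/
inductive Subst.IsCompList : List (Subst V) → Subst V → Prop
  | nil : IsCompList [] Subst.id
  | snoc {θs : List (Subst V)} {κ θ κ' : Subst V} :
      IsCompList θs κ → κ.IsComp θ κ' → IsCompList (θs ++ [θ]) κ'

/-- `r'` is the instance of `r` under `θ`. -/
def Rule.IsInstance (r : Rule V) (θ : Subst V) (r' : Rule V) : Prop :=
  conjSubst θ r.body = some r'.body ∧ r.head.subst θ = some r'.head

/-! ### Herbrand semantics -/

/-- An interpretation `I` (a set of facts) satisfies a rule if, for each of its ground instances,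
the head is in `I` whenever all body atoms are. -/
def Satisfies (I : Set (Atom V)) (r : Rule V) : Prop :=
  ∀ (σ : Subst V) (r' : Rule V), r.IsInstance σ r' → r'.vars = ∅ →
    (∀ b ∈ r'.body, b ∈ I) → r'.head ∈ I

/-- Entailment of a fact by a set of rules: it holds in all Herbrand models of the rules. -/
def Entails (Γ : Set (Rule V)) (a : Atom V) : Prop :=
  ∀ I : Set (Atom V), (∀ b ∈ I, b.IsGround) → (∀ r ∈ Γ, Satisfies I r) → a ∈ I

/-! ### Queries, datasets and hypothetical answers -/

/-- Intensional predicates: those in the head of some rule with non-empty body. -/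
def IsIDB (Γ : Set (Rule V)) (p : V.RigidPred ⊕ V.TemporalPred) : Prop :=
  ∃ r ∈ Γ, r.body ≠ [] ∧ r.head.pred = p

/-- Extensional predicates: those defined by rules with empty body only (if at all). -/
def IsEDB (Γ : Set (Rule V)) (p : V.RigidPred ⊕ V.TemporalPred) : Prop := ¬ IsIDB Γ p

/-- A query `⟨P, Π⟩`: a program (set of safe rules) and an intensional atom. -/
structure Query (V : Vocabulary.{u, v, w}) where
  atom : Atom V
  program : Set (Rule V)
  safe : ∀ r ∈ program, r.IsSafe
  atom_idb : IsIDB program atom.pred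

/-- A dataset (data stream) for a query: a set of extensional facts. -/
def IsDataset (Q : Query V) (D : Set (Atom V)) : Prop :=
  ∀ a ∈ D, a.IsGround ∧ IsEDB Q.program a.pred

/-- The `τ`-history `D_τ`: the facts in `D` whose temporal argument is at most `τ`. -/
def history (D : Set (Atom V)) (τ : ℤ) : Set (Atom V) :=
  {a ∈ D | ∃ p args, ∃ n : ℕ, a = .temporal p args (.point n) ∧ (n : ℤ) ≤ τ}

/-- The program `Π` together with a set of facts. -/
def withFacts (Q : Query V) (F : Set (Atom V)) : Set (Rule V) :=
  Q.program ∪ Rule.ofFact '' F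

/-- `H` is a finite set of ground extensional temporal atoms with time stamps greater than `τ`
such that `Π ∪ D_τ ∪ H ⊨ Pθ`. -/
def IsHypothesisSet (Q : Query V) (D : Set (Atom V)) (τ : ℤ) (θ : Subst V)
    (H : Set (Atom V)) : Prop :=
  H.Finite ∧
  (∀ a ∈ H, a.IsGround ∧ IsEDB Q.program a.pred ∧
    ∃ p args, ∃ n : ℕ, a = .temporal p args (.point n) ∧ τ < (n : ℤ)) ∧
  ∃ c, Q.atom.subst θ = some c ∧ Entails (withFacts Q (history D τ ∪ H)) c

/-- `⟨θ, H⟩` is a hypothetical answer to `Q` over `D_τ`. -/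
def IsHypotheticalAnswer (Q : Query V) (D : Set (Atom V)) (τ : ℤ) (θ : Subst V)
    (H : Set (Atom V)) : Prop :=
  θ.IsGround ∧ θ.supp = Q.atom.vars ∧ Minimal (IsHypothesisSet Q D τ θ) H

/-! ### SLD-resolution -/

/-- `θ` unifies `a` and `b`. -/
def IsUnifier (θ : Subst V) (a b : Atom V) : Prop :=
  ∃ c, a.subst θ = some c ∧ b.subst θ = some c

/-- `θ` is a most general unifier of `a` and `b`. -/
def IsMGU (θ : Subst V) (a b : Atom V) : Prop :=
  IsUnifier θ a b ∧ ∀ σ, IsUnifier σ a b → ∃ γ, θ.IsComp γ σ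

/-- Renaming of the variables of an object term. -/
def ObjTerm.rename (e : ℕ → ℕ) : ObjTerm V → ObjTerm V
  | .const c => .const c
  | .var i => .var (e i)

/-- Renaming of the variable of a time term. -/
def TimeTerm.rename (f : ℕ → ℕ) : TimeTerm → TimeTerm
  | .point n => .point n
  | .add i k => .add (f i) k

/-- Renaming of the variables of an atom. -/
def Atom.rename (e f : ℕ → ℕ) : Atom V → Atom V
  | .rigid p args => .rigid p fun j => (args j).rename e
  | .temporal p args t => .temporal p (fun j => (args j).rename e) (t.rename f)

/-- `C` is an `α`-renaming of `r`: the variables are permuted within each sort. -/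
def Rule.IsRenaming (r C : Rule V) : Prop :=
  ∃ e f : Equiv.Perm ℕ, C = ⟨r.body.map (Atom.rename e f), r.head.rename e f⟩

/-- `G'` is the resolvent of the goal `¬⋀G` and the rule `C`, which share no variable, using a most
general unifier `θ` of the head of `C` and an atom `β` of `G`. As usual for this language, most
general unifiers in derivations are taken such that the terms of their bindings contain only
variables of the selected atom `β`. -/
def IsResolvent (G : List (Atom V)) (C : Rule V) (θ : Subst V) (G' : List (Atom V)) : Prop :=
  Disjoint (conjVars G) C.vars ∧
  ∃ (pre : List (Atom V)) (β : Atom V) (post : List (Atom V)),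
    G = pre ++ β :: post ∧
    IsMGU θ C.head β ∧
    (∀ x ∈ θ.supp, θ.varsAt x ⊆ β.vars) ∧
    conjSubst θ (pre ++ C.body ++ post) = some G'

/-- `IsSLDDerivation Γ G θs G'`: there is a finite SLD-derivation of `Γ ∪ {¬⋀G}` with last goal
`¬⋀G'`, and `θs` is its sequence of most general unifiers. -/
inductive IsSLDDerivation (Γ : Set (Rule V)) (G : List (Atom V)) :
    List (Subst V) → List (Atom V) → Prop
  | nil : IsSLDDerivation Γ G [] G
  | snoc {θs : List (Subst V)} {G₁ : List (Atom V)} {r C : Rule V} {θ : Subst V}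
      {G₂ : List (Atom V)} :
      IsSLDDerivation Γ G θs G₁ → r ∈ Γ → r.IsRenaming C → IsResolvent G₁ C θ G₂ →
      IsSLDDerivation Γ G (θs ++ [θ]) G₂

/-- Future atoms with respect to `τ`: temporal atoms whose time term contains a variable or is a
time point after `τ`. -/
def Atom.IsFuture (τ : ℤ) : Atom V → Prop
  | .rigid _ _ => False
  | .temporal _ _ (.add _ _) => True
  | .temporal _ _ (.point n) => τ < (n : ℤ)

/-- `⟨ρ, ⋀G⟩` is a computed answer with premises to `Q` over `D_τ`: some SLD-derivation of
`Π ∪ D_τ ∪ {¬P}` ends in the goal `¬⋀G`, which consists of future extensional atoms, and `ρ` is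
the restriction to the variables of `P` of the composition of its most general unifiers. -/
def IsComputedAnswer (Q : Query V) (D : Set (Atom V)) (τ : ℤ) (ρ : Subst V)
    (G : List (Atom V)) : Prop :=
  ∃ (θs : List (Subst V)) (κ : Subst V),
    IsSLDDerivation (withFacts Q (history D τ)) [Q.atom] θs G ∧
    (∀ a ∈ G, a.IsFuture τ ∧ IsEDB Q.program a.pred) ∧
    Subst.IsCompList θs κ ∧
    ρ = κ.restrict Q.atom.vars

end TemporalDatalog

/-!
Completeness is proved by ground resolution followed by lifting.

*Ground resolution.* The ground atoms that can be rewritten, by finitely many resolution steps with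
ground instances of rules of `Π ∪ D_τ`, into a list of atoms of `H` form a Herbrand model of
`Π ∪ D_τ ∪ H` (`Entails.exists_groundStep`). Hence `Pθ` can be rewritten into such a list `L`.
Conversely `Pθ` follows from `Π ∪ D_τ ∪ L` (`mem_of_groundStep`), so the minimality of `H` forces
`H` to be the set of members of `L`.

*Lifting.* Each ground step is matched by a step of SLD-resolution (`Lifts.step`). The state to be
preserved is `Lifts`: a derivation from `P` with composed unifier `κ` and last goal `G`, and a
substitution `σ` that turns `G` into the ground goal, such that `κσ` is defined everywhere and
equals `θ` on the variables of `P`. The rule is renamed apart from `G` and from the terms occurring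
in `κ`, and `σ` is redefined on the new variables so as to produce the ground rule instance. Then
`σ` unifies the selected atom with the head of the rule.

*Most general unifiers.* An atom has no nested terms and at most one time term, so a most general
unifier can be written down explicitly (`exists_mgu`). It satisfies `θσ = σ` for *every* unifier
`σ`, so the same `σ` serves for the next goal, and whatever is defined under `σ` is defined under
`θ` (`Atom.subst_of_isComp`): negative time constants never arise.
-/

namespace TemporalDatalog

universe u v w

variable {V : Vocabulary.{u, v, w}}

/-! ### Arithmetic of time terms -/

theorem TimeTerm.addInt_zero (t : TimeTerm) : t.addInt 0 = some t := by
  cases t <;> simp [addInt]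

theorem TimeTerm.addInt_add {t u : TimeTerm} {k : ℤ} (h : t.addInt k = some u) (m : ℤ) :
    t.addInt (k + m) = u.addInt m := by
  cases t with
  | point n =>
    simp only [addInt, Option.ite_none_right_eq_some, Option.some.injEq] at h
    obtain ⟨h0, rfl⟩ := h
    simp only [addInt, Int.toNat_of_nonneg h0, add_assoc]
  | add i j =>
    simp only [addInt, Option.some.injEq] at h
    subst h
    simp [addInt, add_assoc]

theorem TimeTerm.addInt_neg {t u : TimeTerm} {k : ℤ} (h : t.addInt k = some u) :
    u.addInt (-k) = some t := by
  rw [← addInt_add h, add_neg_cancel, addInt_zero]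

theorem TimeTerm.subst_addInt {t u w : TimeTerm} {m : ℤ} {σ : Subst V}
    (hw : t.addInt m = some w) (hu : t.subst σ = some u) : w.subst σ = u.addInt m := by
  cases t with
  | point n =>
    simp only [subst, Option.some.injEq] at hu
    subst hu
    rw [hw]
    simp only [addInt, Option.ite_none_right_eq_some, Option.some.injEq] at hw
    obtain ⟨-, rfl⟩ := hw
    rfl
  | add i j =>
    simp only [addInt, Option.some.injEq] at hw
    subst hw
    exact addInt_add hu m

/-! ### Application of substitutions -/

theorem ObjTerm.subst_congr {σ σ' : Subst V} {t : ObjTerm V}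
    (h : ∀ i, Var.obj i ∈ t.vars → σ.obj i = σ'.obj i) : t.subst σ = t.subst σ' := by
  cases t with
  | const c => rfl
  | var i => exact h i rfl

theorem TimeTerm.subst_congr {σ σ' : Subst V} {t : TimeTerm}
    (h : ∀ i, Var.time i ∈ t.vars → σ.time i = σ'.time i) : t.subst σ = t.subst σ' := by
  cases t with
  | point n => rfl
  | add i k => simp only [subst, h i rfl]

/-- The effect of a substitution on a renamed atom depends only on its values at the renamed
variables. With the identity renaming this is the usual congruence property. -/
theorem Atom.subst_rename_congr {σ σ' : Subst V} {e f : ℕ → ℕ} {a : Atom V}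
    (ho : ∀ i, Var.obj i ∈ a.vars → σ'.obj (e i) = σ.obj i)
    (ht : ∀ i, Var.time i ∈ a.vars → σ'.time (f i) = σ.time i) :
    (a.rename e f).subst σ' = a.subst σ := by
  have hobj : ∀ t : ObjTerm V, t.vars ⊆ a.vars → (t.rename e).subst σ' = t.subst σ := by
    intro t h
    cases t with
    | const c => rfl
    | var i => exact ho i (h rfl)
  have htime : ∀ t : TimeTerm, t.vars ⊆ a.vars → (t.rename f).subst σ' = t.subst σ := by
    intro t h
    cases t with
    | point n => rfl
    | add i k => simp only [TimeTerm.rename, TimeTerm.subst, ht i (h rfl)]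
  cases a with
  | rigid p args =>
    simp only [rename, subst, Option.some.injEq, rigid.injEq, heq_eq_eq, true_and]
    exact funext fun j => hobj _ (Set.subset_iUnion (fun j => (args j).vars) j)
  | temporal p args t =>
    have hargs : (fun j => ((args j).rename e).subst σ') = fun j => (args j).subst σ :=
      funext fun j => hobj _ ((Set.subset_iUnion (fun j => (args j).vars) j).trans
        Set.subset_union_left)
    simp only [rename, subst, htime t Set.subset_union_right, hargs]

theorem Atom.rename_id (a : Atom V) : a.rename (fun i => i) (fun i => i) = a := by
  have ho : ∀ t : ObjTerm V, t.rename (fun i => i) = t := by rintro (_ | _) <;> rfl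
  have ht : ∀ t : TimeTerm, t.rename (fun i => i) = t := by rintro (_ | _) <;> rfl
  cases a <;> simp [rename, ho, ht]

theorem Atom.subst_congr {σ σ' : Subst V} {a : Atom V}
    (ho : ∀ i, Var.obj i ∈ a.vars → σ.obj i = σ'.obj i)
    (ht : ∀ i, Var.time i ∈ a.vars → σ.time i = σ'.time i) : a.subst σ = a.subst σ' := by
  have := subst_rename_congr (e := fun i => i) (f := fun i => i) ho ht
  rwa [rename_id] at this

theorem Atom.subst_id (a : Atom V) : a.subst Subst.id = some a := by
  have ho : ∀ t : ObjTerm V, t.subst Subst.id = t := by rintro (_ | _) <;> rfl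
  have ht : ∀ t : TimeTerm, t.subst (Subst.id : Subst V) = some t := by
    rintro (_ | _) <;> simp [TimeTerm.subst, Subst.id, TimeTerm.var, TimeTerm.addInt]
  cases a <;> simp [subst, ho, ht]

theorem Atom.IsGround.subst {a : Atom V} (ha : a.IsGround) (σ : Subst V) :
    a.subst σ = some a := by
  rw [← subst_id a]
  have ha : a.vars = ∅ := ha
  exact subst_congr (by simp [ha]) (by simp [ha])

theorem Atom.pred_subst {a b : Atom V} {σ : Subst V} (h : a.subst σ = some b) :
    b.pred = a.pred := by
  cases a with
  | rigid p args =>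
    cases h
    rfl
  | temporal p args t =>
    obtain ⟨u, -, rfl⟩ := Option.map_eq_some_iff.1 h
    rfl

theorem ObjTerm.subst_of_isComp {θ σ κ : Subst V} (h : θ.IsComp σ κ) (t : ObjTerm V) :
    (t.subst θ).subst σ = t.subst κ := by
  cases t with
  | const c => rfl
  | var i => exact h.1 i

theorem TimeTerm.subst_of_isComp {θ σ κ : Subst V} (h : θ.IsComp σ κ) {t u : TimeTerm}
    (hu : t.subst κ = some u) : ∃ s, t.subst θ = some s ∧ s.subst σ = some u := by
  cases t with
  | point n => exact ⟨.point n, rfl, hu⟩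
  | add i k =>
    have hs : ∃ s, (θ.time i).addInt k = some s := by
      have hi := h.2 i
      cases hθ : θ.time i with
      | point n =>
        -- A constant is not changed by `σ`, so the addition is the one performed by `κ`.
        rw [hθ, subst, Option.some.injEq] at hi
        exact ⟨u, by rw [hi]; exact hu⟩
      | add j m => exact ⟨_, rfl⟩
    obtain ⟨s, hs⟩ := hs
    exact ⟨s, hs, (subst_addInt hs (h.2 i)).trans hu⟩

/-- If `κ = θσ` and `aκ` is defined, then so is `aθ`, and `(aθ)σ = aκ`. -/
theorem Atom.subst_of_isComp {θ σ κ : Subst V} (h : θ.IsComp σ κ) {a b : Atom V}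
    (hb : a.subst κ = some b) : ∃ c, a.subst θ = some c ∧ c.subst σ = some b := by
  cases a with
  | rigid p args =>
    refine ⟨_, rfl, ?_⟩
    rw [← hb]
    simp only [subst, ObjTerm.subst_of_isComp h]
  | temporal p args t =>
    obtain ⟨u, hu, rfl⟩ := Option.map_eq_some_iff.1 hb
    obtain ⟨s, hs, hsu⟩ := TimeTerm.subst_of_isComp h hu
    refine ⟨.temporal p (fun j => (args j).subst θ) s, by simp [subst, hs], ?_⟩
    simp [subst, hsu, ObjTerm.subst_of_isComp h]

theorem conjSubst_eq_some_iff {σ : Subst V} {G G' : List (Atom V)} :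
    conjSubst σ G = some G' ↔ List.Forall₂ (fun a b => a.subst σ = some b) G G' := by
  unfold conjSubst
  induction G generalizing G' with
  | nil => simp [eq_comm]
  | cons a G ih =>
    rw [List.forall₂_cons_left_iff]
    simp only [List.mapM_cons, Option.bind_eq_bind, Option.bind_eq_some_iff, ih]
    constructor
    · rintro ⟨b, hb, L, hL, h⟩
      cases h
      exact ⟨b, L, hb, hL, rfl⟩
    · rintro ⟨b, L, hb, hL, rfl⟩
      exact ⟨b, hb, L, hL, rfl⟩

theorem conjSubst_of_isComp {θ σ κ : Subst V} (h : θ.IsComp σ κ) {G G' : List (Atom V)}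
    (hG : conjSubst κ G = some G') :
    ∃ G₁, conjSubst θ G = some G₁ ∧ conjSubst σ G₁ = some G' := by
  simp only [conjSubst_eq_some_iff] at hG ⊢
  induction hG with
  | nil => exact ⟨[], .nil, .nil⟩
  | cons hab _ ih =>
    obtain ⟨c, hc, hcb⟩ := Atom.subst_of_isComp h hab
    obtain ⟨L, hL, hL'⟩ := ih
    exact ⟨c :: L, .cons hc hL, .cons hcb hL'⟩

/-- The composition `κθ` exists as soon as it is defined at each time variable. -/
theorem Subst.exists_isComp {κ θ : Subst V} (h : ∀ i, ∃ u, (κ.time i).subst θ = some u) :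
    ∃ κ', κ.IsComp θ κ' := by
  choose f hf using h
  refine ⟨⟨fun i => (κ.obj i).subst θ, f, ?_, ?_⟩, fun i => rfl, hf⟩
  · refine (κ.finite_obj.union θ.finite_obj).subset fun i hi => ?_
    by_contra hn
    simp only [Set.mem_union, Set.mem_ofPred_eq, not_or, not_not] at hn
    refine hi ?_
    rw [hn.1]
    exact hn.2
  · refine (κ.finite_time.union θ.finite_time).subset fun i hi => ?_
    by_contra hn
    simp only [Set.mem_union, Set.mem_ofPred_eq, not_or, not_not] at hn
    refine hi ?_
    have := hf i
    rw [hn.1, TimeTerm.var, TimeTerm.subst, TimeTerm.addInt_zero, hn.2] at this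
    exact (Option.some.inj this).symm

/-! ### Finiteness of variable sets and renaming apart -/

theorem ObjTerm.finite_vars (t : ObjTerm V) : t.vars.Finite := by
  cases t <;> simp [vars]

theorem TimeTerm.finite_vars (t : TimeTerm) : t.vars.Finite := by
  cases t <;> simp [vars]

theorem Atom.finite_vars (a : Atom V) : a.vars.Finite := by
  cases a with
  | rigid p args => exact Set.finite_iUnion fun j => (args j).finite_vars
  | temporal p args t =>
    exact (Set.finite_iUnion fun j => (args j).finite_vars).union t.finite_vars

theorem finite_conjVars (G : List (Atom V)) : (conjVars G).Finite := by
  have : conjVars G = ⋃ a ∈ {a | a ∈ G}, a.vars := by ext; simp [conjVars]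
  rw [this]
  exact (List.finite_toSet G).biUnion fun a _ => a.finite_vars

theorem Rule.finite_vars (r : Rule V) : r.vars.Finite :=
  (finite_conjVars _).union r.head.finite_vars

theorem Subst.finite_supp (θ : Subst V) : θ.supp.Finite := by
  refine ((θ.finite_obj.image Var.obj).union (θ.finite_time.image Var.time)).subset ?_
  rintro (i | i) hi
  · exact .inl ⟨i, hi, rfl⟩
  · exact .inr ⟨i, hi, rfl⟩

theorem Subst.finite_varsAt (θ : Subst V) (x : Var) : (θ.varsAt x).Finite := by
  cases x
  · exact ObjTerm.finite_vars _
  · exact TimeTerm.finite_vars _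

/-- The index of a variable within its sort. -/
def Var.index : Var → ℕ
  | .obj i => i
  | .time i => i

/-- Some permutation of `ℕ` moves all of `[0, N)` to numbers that are at least `N`. -/
theorem exists_perm_le (N : ℕ) : ∃ e : Equiv.Perm ℕ, ∀ i < N, N ≤ e i := by
  have h : Function.Involutive
      (fun i => if i < N then i + N else if i < 2 * N then i - N else i) := by
    intro i
    dsimp only
    split_ifs <;> omega
  exact ⟨h.toPerm, fun i hi => by simp [hi]⟩

theorem Atom.mem_vars_rename {e f : ℕ → ℕ} {a : Atom V} {x : Var}
    (hx : x ∈ (a.rename e f).vars) :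
    ∃ y ∈ a.vars, x = match y with | .obj i => .obj (e i) | .time i => .time (f i) := by
  have hobj : ∀ t : ObjTerm V, x ∈ (t.rename e).vars → ∃ i, .obj i ∈ t.vars ∧ x = .obj (e i) := by
    rintro (c | i) h
    · exact h.elim
    · exact ⟨i, rfl, h⟩
  have htime : ∀ t : TimeTerm, x ∈ (t.rename f).vars → ∃ i, .time i ∈ t.vars ∧ x = .time (f i) := by
    rintro (c | ⟨i, k⟩) h
    · exact h.elim
    · exact ⟨i, rfl, h⟩
  cases a with
  | rigid p args =>
    obtain ⟨j, hj⟩ := Set.mem_iUnion.1 hx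
    obtain ⟨i, hi, rfl⟩ := hobj _ hj
    exact ⟨.obj i, Set.mem_iUnion.2 ⟨j, hi⟩, rfl⟩
  | temporal p args t =>
    rcases hx with hx | hx
    · obtain ⟨j, hj⟩ := Set.mem_iUnion.1 hx
      obtain ⟨i, hi, rfl⟩ := hobj _ hj
      exact ⟨.obj i, .inl (Set.mem_iUnion.2 ⟨j, hi⟩), rfl⟩
    · obtain ⟨i, hi, rfl⟩ := htime _ hx
      exact ⟨.time i, .inr hi, rfl⟩

theorem Rule.mem_vars_rename {r : Rule V} {e f : ℕ → ℕ} {x : Var}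
    (hx : x ∈ (Rule.mk (r.body.map (Atom.rename e f)) (r.head.rename e f)).vars) :
    ∃ y ∈ r.vars, x = match y with | .obj i => .obj (e i) | .time i => .time (f i) := by
  rcases hx with ⟨a, ha, hx⟩ | hx
  · obtain ⟨b, hb, rfl⟩ := List.mem_map.1 ha
    obtain ⟨y, hy, h⟩ := Atom.mem_vars_rename hx
    exact ⟨y, .inl ⟨b, hb, hy⟩, h⟩
  · obtain ⟨y, hy, h⟩ := Atom.mem_vars_rename hx
    exact ⟨y, .inr hy, h⟩

/-- A ground instance of a rule can be produced from a variant of the rule with variables outside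
a given finite set, by a substitution that agrees with a given one outside the variant. -/
theorem Rule.IsInstance.exists_fresh {r r' : Rule V} {σr : Subst V} (h : r.IsInstance σr r')
    (σ : Subst V) {F : Set Var} (hF : F.Finite) :
    ∃ (C : Rule V) (σ' : Subst V), r.IsRenaming C ∧ Disjoint F C.vars ∧ C.IsInstance σ' r' ∧
      (∀ i, Var.obj i ∉ C.vars → σ'.obj i = σ.obj i) ∧
      (∀ i, Var.time i ∉ C.vars → σ'.time i = σ.time i) := by
  classical
  obtain ⟨N, hN⟩ : ∃ N, ∀ x ∈ F ∪ r.vars, x.index < N := by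
    obtain ⟨N, hN⟩ := ((hF.union r.finite_vars).image Var.index).bddAbove
    exact ⟨N + 1, fun x hx => Nat.lt_succ_of_le (hN ⟨x, hx, rfl⟩)⟩
  obtain ⟨e, he⟩ := exists_perm_le N
  set C : Rule V := ⟨r.body.map (Atom.rename e e), r.head.rename e e⟩ with hC
  have hCfin := C.finite_vars
  let σ' : Subst V :=
    { obj := fun i => if Var.obj i ∈ C.vars then σr.obj (e.symm i) else σ.obj i
      time := fun i => if Var.time i ∈ C.vars then σr.time (e.symm i) else σ.time i
      finite_obj := by
        refine ((hCfin.image Var.index).union σ.finite_obj).subset fun i hi => ?_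
        by_cases h : Var.obj i ∈ C.vars
        · exact .inl ⟨_, h, rfl⟩
        · exact .inr (by simpa [h] using hi)
      finite_time := by
        refine ((hCfin.image Var.index).union σ.finite_time).subset fun i hi => ?_
        by_cases h : Var.time i ∈ C.vars
        · exact .inl ⟨_, h, rfl⟩
        · exact .inr (by simpa [h] using hi) }
  have hrename : ∀ a : Atom V, (a.rename e e).vars ⊆ C.vars →
      (a.rename e e).subst σ' = a.subst σr := by
    intro a ha
    apply Atom.subst_rename_congr
    · intro i hi
      have : Var.obj (e i) ∈ C.vars := ha (by
        cases a with
        | rigid p args =>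
          obtain ⟨j, hj⟩ := Set.mem_iUnion.1 hi
          refine Set.mem_iUnion.2 ⟨j, ?_⟩
          cases hargs : args j <;> simp_all [ObjTerm.vars, ObjTerm.rename]
        | temporal p args t =>
          rcases hi with hi | hi
          · obtain ⟨j, hj⟩ := Set.mem_iUnion.1 hi
            refine .inl (Set.mem_iUnion.2 ⟨j, ?_⟩)
            cases hargs : args j <;> simp_all [ObjTerm.vars, ObjTerm.rename]
          · cases t <;> simp [TimeTerm.vars] at hi)
      simp [σ', this]
    · intro i hi
      have : Var.time (e i) ∈ C.vars := ha (by
        cases a with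
        | rigid p args =>
          obtain ⟨j, hj⟩ := Set.mem_iUnion.1 hi
          cases hargs : args j <;> simp_all [ObjTerm.vars]
        | temporal p args t =>
          rcases hi with hi | hi
          · obtain ⟨j, hj⟩ := Set.mem_iUnion.1 hi
            cases hargs : args j <;> simp_all [ObjTerm.vars]
          · refine .inr ?_
            cases t <;> simp_all [TimeTerm.vars, TimeTerm.rename])
      simp [σ', this]
  refine ⟨C, σ', ⟨e, e, rfl⟩, ?_, ⟨?_, ?_⟩, ?_, ?_⟩
  · refine Set.disjoint_left.2 fun x hxF hxC => ?_
    obtain ⟨y, hy, rfl⟩ := Rule.mem_vars_rename hxC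
    have h₁ := hN y (.inr hy)
    have h₂ := hN _ (.inl hxF)
    cases y <;> exact absurd h₂ (not_lt.2 (he _ h₁))
  · have hb := h.1
    rw [conjSubst_eq_some_iff] at hb ⊢
    rw [hC, List.forall₂_map_left_iff]
    refine List.forall₂_iff_get.2 ⟨hb.length_eq, fun i h₁ h₂ => ?_⟩
    rw [hrename]
    · exact (List.forall₂_iff_get.1 hb).2 i h₁ h₂
    · exact fun x hx => .inl ⟨_, List.mem_map_of_mem (List.get_mem _ _), hx⟩
  · rw [hC, hrename _ (fun x hx => .inr hx)]
    exact h.2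
  · intro i hi
    simp [σ', hi]
  · intro i hi
    simp [σ', hi]

/-! ### Most general unifiers -/

/-- The object part of a most general unifier of two rows of object terms. Terms that are identified
by all unifiers receive the same representative, a constant or else a term of the second row. -/
theorem exists_obj_mgu {n : ℕ} (s t : Fin n → ObjTerm V)
    (σ₀ : Subst V) (h₀ : ∀ j, (s j).subst σ₀ = (t j).subst σ₀) :
    ∃ θ : ℕ → ObjTerm V, {i | θ i ≠ .var i}.Finite ∧
      (∀ κ : Subst V, κ.obj = θ → ∀ j, (s j).subst κ = (t j).subst κ) ∧
      (∀ σ : Subst V, (∀ j, (s j).subst σ = (t j).subst σ) → ∀ i, (θ i).subst σ = σ.obj i) ∧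
      ∀ i, θ i ≠ .var i → (θ i).vars ⊆ ⋃ j, (t j).vars := by
  classical
  let R : ObjTerm V → ObjTerm V → Prop := fun a b =>
    ∀ σ : Subst V, (∀ j, (s j).subst σ = (t j).subst σ) → a.subst σ = b.subst σ
  let rep : (ObjTerm V → Prop) → ObjTerm V → ObjTerm V := fun A d =>
    if h : ∃ c, A (.const c) then .const h.choose
    else if h : ∃ j, A (t j) then t h.choose else d
  have hst : ∀ j, R (s j) (t j) := fun j σ hσ => hσ j
  have hRrep : ∀ a, R a (rep (R a) a) := by
    intro a
    by_cases h₁ : ∃ c, R a (.const c)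
    · simp only [rep, dif_pos h₁]
      exact h₁.choose_spec
    · by_cases h₂ : ∃ j, R a (t j)
      · simp only [rep, dif_neg h₁, dif_pos h₂]
        exact h₂.choose_spec
      · simp only [rep, dif_neg h₁, dif_neg h₂]
        exact fun σ _ => rfl
  have hrepeq : ∀ j, rep (R (s j)) (s j) = rep (R (t j)) (t j) := by
    intro j
    have hR : R (s j) = R (t j) := by
      funext b
      exact propext ⟨fun h σ hσ => (hst j σ hσ).symm.trans (h σ hσ),
        fun h σ hσ => (hst j σ hσ).trans (h σ hσ)⟩
    have h₂ : ∃ j', R (t j) (t j') := ⟨j, fun σ _ => rfl⟩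
    simp only [rep, hR, dif_pos h₂]
  have hconst : ∀ c d, rep (R (.const c)) d = .const c := by
    intro c d
    have h₁ : ∃ c', R (.const c) (.const c') := ⟨c, fun σ _ => rfl⟩
    simp only [rep, dif_pos h₁]
    -- Distinct constants are not identified, as there is a unifier.
    exact (h₁.choose_spec σ₀ h₀).symm
  have hfin : {i : ℕ | ObjTerm.var i ∈ Set.range s ∪ Set.range t}.Finite :=
    ((Set.finite_range s).union (Set.finite_range t)).preimage
      (fun a _ b _ h => ObjTerm.var.inj h)
  let θ : ℕ → ObjTerm V := fun i =>
    if ObjTerm.var i ∈ Set.range s ∪ Set.range t then rep (R (.var i)) (.var i) else .var i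
  have hθ : ∀ κ : Subst V, κ.obj = θ → ∀ a ∈ Set.range s ∪ Set.range t,
      a.subst κ = rep (R a) a := by
    rintro κ hκ (c | i) ha
    · exact (hconst c _).symm
    · simp only [ObjTerm.subst, hκ, θ, if_pos ha]
  refine ⟨θ, hfin.subset fun i hi => ?_, fun κ hκ j => ?_, fun σ hσ i => ?_, fun i hi => ?_⟩
  · by_contra hn
    exact hi (if_neg hn)
  · rw [hθ κ hκ _ (.inl ⟨j, rfl⟩), hθ κ hκ _ (.inr ⟨j, rfl⟩), hrepeq]
  · by_cases h : ObjTerm.var i ∈ Set.range s ∪ Set.range t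
    · simp only [θ, if_pos h]
      exact (hRrep _ σ hσ).symm
    · simp only [θ, if_neg h]
      rfl
  · by_cases h : ObjTerm.var i ∈ Set.range s ∪ Set.range t
    · simp only [θ, if_pos h] at hi ⊢
      by_cases h₁ : ∃ c, R (.var i) (.const c)
      · simp only [rep, dif_pos h₁]
        exact Set.empty_subset _
      · by_cases h₂ : ∃ j, R (.var i) (t j)
        · simp only [rep, dif_neg h₁, dif_pos h₂]
          exact Set.subset_iUnion (fun j => (t j).vars) _
        · simp only [rep, dif_neg h₁, dif_neg h₂, ne_eq, not_true_eq_false] at hi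
    · simp only [θ, if_neg h, ne_eq, not_true_eq_false] at hi

/-- Unification of `T + k` with a time term `t` in which `T` does not occur binds `T` to
`t - k`. -/
theorem exists_time_mgu_add (i : ℕ) (k : ℤ) (t : TimeTerm) (hi : Var.time i ∉ t.vars)
    (σ₀ : Subst V) {u₀ : TimeTerm} (h₀ : (TimeTerm.add i k).subst σ₀ = some u₀)
    (h₀' : t.subst σ₀ = some u₀) :
    ∃ θ : ℕ → TimeTerm, {i | θ i ≠ .var i}.Finite ∧
      (∀ κ : Subst V, κ.time = θ → (TimeTerm.add i k).subst κ = some t ∧ t.subst κ = some t) ∧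
      (∀ (σ : Subst V) (u : TimeTerm), (TimeTerm.add i k).subst σ = some u → t.subst σ = some u →
        ∀ i, (θ i).subst σ = some (σ.time i)) ∧
      ∀ i, θ i ≠ .var i → (θ i).vars ⊆ t.vars := by
  obtain ⟨w, hw⟩ : ∃ w, t.addInt (-k) = some w := by
    cases t with
    | point n =>
      cases h₀'
      exact ⟨_, TimeTerm.addInt_neg h₀⟩
    | add j m => exact ⟨_, rfl⟩
  have hwt : w.addInt k = some t := by simpa using TimeTerm.addInt_neg hw
  have hvars : w.vars = t.vars := by
    cases t with
    | point n =>
      simp only [TimeTerm.addInt, Option.ite_none_right_eq_some, Option.some.injEq] at hw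
      obtain ⟨-, rfl⟩ := hw
      rfl
    | add j m =>
      cases hw
      rfl
  refine ⟨Function.update TimeTerm.var i w, ?_, ?_, ?_, ?_⟩
  · refine (Set.finite_singleton i).subset fun j hj => ?_
    by_contra hn
    exact hj (Function.update_of_ne hn _ _)
  · intro κ hκ
    refine ⟨by simpa [TimeTerm.subst, hκ] using hwt, ?_⟩
    cases t with
    | point n => rfl
    | add j m =>
      have hj : j ≠ i := fun h => hi (by simp [TimeTerm.vars, h])
      simp [TimeTerm.subst, hκ, hj, TimeTerm.var, TimeTerm.addInt]
  · intro σ u hs ht j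
    by_cases hj : j = i
    · subst hj
      rw [Function.update_self, TimeTerm.subst_addInt hw ht]
      exact TimeTerm.addInt_neg hs
    · rw [Function.update_of_ne hj]
      exact TimeTerm.addInt_zero _
  · intro j hj
    by_cases hji : j = i
    · subst hji
      rw [Function.update_self, hvars]
    · rw [Function.update_of_ne hji] at hj
      exact absurd rfl hj

/-- The time part of a most general unifier. -/
theorem exists_time_mgu (s t : TimeTerm) (hd : Disjoint s.vars t.vars)
    (σ₀ : Subst V) {u₀ : TimeTerm} (h₀ : s.subst σ₀ = some u₀) (h₀' : t.subst σ₀ = some u₀) :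
    ∃ θ : ℕ → TimeTerm, {i | θ i ≠ .var i}.Finite ∧
      (∀ κ : Subst V, κ.time = θ → ∃ u, s.subst κ = some u ∧ t.subst κ = some u) ∧
      (∀ (σ : Subst V) (u : TimeTerm), s.subst σ = some u → t.subst σ = some u →
        ∀ i, (θ i).subst σ = some (σ.time i)) ∧
      ∀ i, θ i ≠ .var i → (θ i).vars ⊆ t.vars := by
  cases s with
  | add i k =>
    obtain ⟨θ, h₁, h₂, h₃, h₄⟩ :=
      exists_time_mgu_add i k t (Set.disjoint_left.1 hd rfl) σ₀ h₀ h₀'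
    exact ⟨θ, h₁, fun κ hκ => ⟨_, h₂ κ hκ⟩, h₃, h₄⟩
  | point m =>
    cases t with
    | point n =>
      cases h₀
      cases h₀'
      exact ⟨.var, by simp, fun κ _ => ⟨_, rfl, rfl⟩, fun σ u _ _ i => TimeTerm.addInt_zero _,
        fun i hi => absurd rfl hi⟩
    | add j l =>
      obtain ⟨θ, h₁, h₂, h₃, h₄⟩ :=
        exists_time_mgu_add j l (.point m) (by simp [TimeTerm.vars]) σ₀ h₀' h₀
      exact ⟨θ, h₁, fun κ hκ => ⟨_, (h₂ κ hκ).symm⟩, fun σ u hs ht => h₃ σ u ht hs,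
        fun i hi => (h₄ i hi).trans (Set.empty_subset _)⟩

/-- Unifiable atoms without common variables have a most general unifier `θ` whose bindings contain
only variables of the second atom, and such that `θσ = σ` for every unifier `σ`. -/
theorem exists_mgu {a b : Atom V} (hd : Disjoint a.vars b.vars) {σ₀ : Subst V}
    (h₀ : IsUnifier σ₀ a b) :
    ∃ θ : Subst V, IsUnifier θ a b ∧ (∀ σ, IsUnifier σ a b → θ.IsComp σ σ) ∧
      ∀ x ∈ θ.supp, θ.varsAt x ⊆ b.vars := by
  obtain ⟨c, ha, hb⟩ := h₀
  cases a with
  | rigid p s =>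
    cases b with
    | temporal q t v =>
      obtain ⟨_, -, rfl⟩ := Option.map_eq_some_iff.1 hb
      cases ha
    | rigid q t =>
      obtain rfl : q = p := by
        have := (Atom.pred_subst hb).symm.trans (Atom.pred_subst ha)
        exact Sum.inl.inj this
      have heq : ∀ {σ : Subst V}, IsUnifier σ (.rigid q s) (.rigid q t) →
          ∀ j, (s j).subst σ = (t j).subst σ := by
        rintro σ ⟨c, hs, ht⟩
        have := hs.trans ht.symm
        simp only [Atom.subst, Option.some.injEq, Atom.rigid.injEq, heq_eq_eq, true_and] at this
        exact congrFun this
      obtain ⟨θ, hfin, hun, hmg, hv⟩ := exists_obj_mgu s t σ₀ (heq ⟨c, ha, hb⟩)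
      refine ⟨⟨θ, .var, hfin, by simp⟩, ⟨_, rfl, ?_⟩, fun σ hσ => ⟨hmg σ (heq hσ), fun i => ?_⟩, ?_⟩
      · simp only [Atom.subst, hun ⟨θ, .var, hfin, by simp⟩ rfl]
      · exact TimeTerm.addInt_zero _
      · rintro (i | i) hi
        · exact hv i hi
        · exact absurd rfl hi
  | temporal p s v =>
    cases b with
    | rigid q t =>
      obtain ⟨_, -, rfl⟩ := Option.map_eq_some_iff.1 ha
      cases hb
    | temporal q t v' =>
      obtain rfl : q = p := by
        have := (Atom.pred_subst hb).symm.trans (Atom.pred_subst ha)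
        exact Sum.inr.inj this
      have heq : ∀ {σ : Subst V}, IsUnifier σ (.temporal q s v) (.temporal q t v') →
          (∀ j, (s j).subst σ = (t j).subst σ) ∧
            ∃ u, v.subst σ = some u ∧ v'.subst σ = some u := by
        rintro σ ⟨c, hs, ht⟩
        obtain ⟨u, hu, rfl⟩ := Option.map_eq_some_iff.1 hs
        obtain ⟨u', hu', h⟩ := Option.map_eq_some_iff.1 ht
        simp only [Atom.temporal.injEq, heq_eq_eq, true_and] at h
        exact ⟨fun j => (congrFun h.1 j).symm, u, hu, h.2 ▸ hu'⟩
      obtain ⟨hobj, u₀, hu, hu'⟩ := heq ⟨c, ha, hb⟩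
      obtain ⟨θ, hfin, hun, hmg, hv⟩ := exists_obj_mgu s t σ₀ hobj
      obtain ⟨η, hfin', hun', hmg', hv'⟩ := exists_time_mgu v v'
        (hd.mono Set.subset_union_right Set.subset_union_right) σ₀ hu hu'
      let κ : Subst V := ⟨θ, η, hfin, hfin'⟩
      obtain ⟨u, hvu, hvu'⟩ := hun' κ rfl
      refine ⟨κ, ⟨.temporal q (fun j => (s j).subst κ) u, ?_, ?_⟩, fun σ hσ => ?_, ?_⟩
      · simp [Atom.subst, hvu]
      · simp [Atom.subst, hvu', hun κ rfl]
      · obtain ⟨h₁, u₁, h₂, h₃⟩ := heq hσ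
        exact ⟨hmg σ h₁, hmg' σ u₁ h₂ h₃⟩
      · rintro (i | i) hi
        · exact (hv i hi).trans Set.subset_union_left
        · exact (hv' i hi).trans Set.subset_union_right

/-! ### Ground resolution and Herbrand semantics -/

/-- One step of ground resolution: an atom of the goal is replaced with the body of a ground rule
instance of which it is the head. -/
def GroundStep (Γ : Set (Rule V)) (G G' : List (Atom V)) : Prop :=
  ∃ (pre post : List (Atom V)) (r r' : Rule V) (σ : Subst V), r ∈ Γ ∧ r.IsInstance σ r' ∧
    r'.vars = ∅ ∧ G = pre ++ r'.head :: post ∧ G' = pre ++ r'.body ++ post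

open Relation (ReflTransGen)

theorem GroundStep.append_reflTransGen {Γ : Set (Rule V)} {G G' : List (Atom V)}
    (h : ReflTransGen (GroundStep Γ) G G') (K L : List (Atom V)) :
    ReflTransGen (GroundStep Γ) (K ++ G ++ L) (K ++ G' ++ L) := by
  refine h.lift (fun G => K ++ G ++ L) ?_
  rintro _ _ ⟨pre, post, r, r', σ, hr, hi, hg, rfl, rfl⟩
  exact ⟨K ++ pre, post ++ L, r, r', σ, hr, hi, hg, by simp, by simp⟩

/-- Goals all of whose atoms can be resolved into lists of atoms of `H` can be resolved into such a
list themselves. -/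
theorem exists_groundStep_list {Γ : Set (Rule V)} {H : Set (Atom V)} (G : List (Atom V))
    (h : ∀ a ∈ G, ∃ L, (∀ b ∈ L, b ∈ H) ∧ ReflTransGen (GroundStep Γ) [a] L) :
    ∃ L, (∀ b ∈ L, b ∈ H) ∧ ReflTransGen (GroundStep Γ) G L := by
  induction G with
  | nil => exact ⟨[], by simp, .refl⟩
  | cons a G ih =>
    obtain ⟨L₁, hL₁, h₁⟩ := h a (by simp)
    obtain ⟨L₂, hL₂, h₂⟩ := ih fun b hb => h b (by simp [hb])
    refine ⟨L₁ ++ L₂, fun b hb => (List.mem_append.1 hb).elim (hL₁ b) (hL₂ b), ?_⟩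
    have h₁' := GroundStep.append_reflTransGen h₁ [] G
    have h₂' := GroundStep.append_reflTransGen h₂ L₁ []
    simp only [List.nil_append, List.append_nil, List.singleton_append] at h₁' h₂'
    exact h₁'.trans h₂'

/-- Completeness of ground resolution: the ground atoms that can be resolved into atoms of `H` form
a Herbrand model. -/
theorem Entails.exists_groundStep {Γ : Set (Rule V)} {H : Set (Atom V)}
    (hH : ∀ a ∈ H, a.IsGround) {c : Atom V} (h : Entails (Γ ∪ Rule.ofFact '' H) c) :
    ∃ L, (∀ b ∈ L, b ∈ H) ∧ ReflTransGen (GroundStep Γ) [c] L := by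
  refine (h {a | a.IsGround ∧ ∃ L, (∀ b ∈ L, b ∈ H) ∧ ReflTransGen (GroundStep Γ) [a] L}
    (fun b hb => hb.1) ?_).2
  rintro r (hr | ⟨a, ha, rfl⟩) σ r' hi hg hbody
  · have hground : r'.head.IsGround := (Set.union_empty_iff.1 hg).2
    obtain ⟨L, hL, hGL⟩ := exists_groundStep_list r'.body fun b hb => (hbody b hb).2
    exact ⟨hground, L, hL, .head ⟨[], [], r, r', σ, hr, hi, hg, by simp, by simp⟩ hGL⟩
  · have hhead : some a = some r'.head := ((hH a ha).subst σ).symm.trans hi.2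
    obtain rfl := Option.some.inj hhead
    exact ⟨hH _ ha, [r'.head], by simpa using ha, .refl⟩

/-- Soundness of ground resolution. -/
theorem mem_of_groundStep {Γ : Set (Rule V)} {I : Set (Atom V)} (hI : ∀ r ∈ Γ, Satisfies I r)
    {G L : List (Atom V)} (h : ReflTransGen (GroundStep Γ) G L) (hL : ∀ b ∈ L, b ∈ I) :
    ∀ a ∈ G, a ∈ I := by
  induction h using ReflTransGen.head_induction_on with
  | refl => exact hL
  | head hstep _ ih =>
    obtain ⟨pre, post, r, r', σ, hr, hi, hg, rfl, rfl⟩ := hstep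
    intro a ha
    simp only [List.mem_append, List.mem_cons] at ha ih
    rcases ha with ha | rfl | ha
    · exact ih a (.inl (.inl ha))
    · exact hI r hr σ r' hi hg fun b hb => ih b (.inl (.inr hb))
    · exact ih a (.inr ha)

theorem Satisfies.mem_of_ofFact {I : Set (Atom V)} {a : Atom V} (ha : a.IsGround)
    (h : Satisfies I (Rule.ofFact a)) : a ∈ I := by
  refine h Subst.id (Rule.ofFact a) ⟨rfl, Atom.subst_id a⟩ ?_ (by simp [Rule.ofFact])
  have ha : a.vars = ∅ := ha
  simp [Rule.ofFact, Rule.vars, conjVars, ha]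

/-- The hypotheses of a hypothetical answer are exactly the atoms left over by some ground
resolution of `Pθ`. -/
theorem IsHypotheticalAnswer.exists_groundStep {Q : Query V} {D : Set (Atom V)} {τ : ℤ}
    {θ : Subst V} {H : Set (Atom V)} (h : IsHypotheticalAnswer Q D τ θ H) :
    ∃ c L, Q.atom.subst θ = some c ∧
      ReflTransGen (GroundStep (withFacts Q (history D τ))) [c] L ∧ H = {b | b ∈ L} := by
  obtain ⟨-, -, ⟨hfin, hH, c, hc, hent⟩, hmin⟩ := h
  have hunion : ∀ K : Set (Atom V), withFacts Q (history D τ ∪ K) =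
      withFacts Q (history D τ) ∪ Rule.ofFact '' K := fun K => by
    simp only [withFacts, Set.image_union, Set.union_assoc]
  rw [hunion] at hent
  obtain ⟨L, hL, hcL⟩ := hent.exists_groundStep fun a ha => (hH a ha).1
  refine ⟨c, L, hc, hcL, Set.Subset.antisymm (hmin ?_ hL) hL⟩
  refine ⟨hfin.subset hL, fun a ha => hH a (hL a ha), c, hc, fun I _ hI => ?_⟩
  rw [hunion] at hI
  refine mem_of_groundStep (fun r hr => hI r (.inl hr)) hcL (fun b hb => ?_) c (by simp)
  exact (hI _ (.inr ⟨b, hb, rfl⟩)).mem_of_ofFact (hH b (hL b hb)).1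

/-! ### Lifting -/

/-- The ground goal `L` lifts to an SLD-derivation from `P`: the composition `κ` of its most general
unifiers is defined, and some `σ` maps the last goal `G` to `L`, is defined on all terms of `κ`, and
is such that `κσ` coincides with `θ` on the variables of `P`. -/
def Lifts (Γ : Set (Rule V)) (P : Atom V) (θ : Subst V) (L : List (Atom V)) : Prop :=
  ∃ (θs : List (Subst V)) (G : List (Atom V)) (κ σ : Subst V),
    IsSLDDerivation Γ [P] θs G ∧ Subst.IsCompList θs κ ∧ conjSubst σ G = some L ∧
    (∀ i, ∃ u, (κ.time i).subst σ = some u) ∧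
    (∀ i, Var.obj i ∈ P.vars → (κ.obj i).subst σ = θ.obj i) ∧
    (∀ i, Var.time i ∈ P.vars → (κ.time i).subst σ = some (θ.time i))

theorem Lifts.refl (Γ : Set (Rule V)) {P c : Atom V} {θ : Subst V} (hc : P.subst θ = some c) :
    Lifts Γ P θ [c] :=
  ⟨[], [P], Subst.id, θ, .nil, .nil, conjSubst_eq_some_iff.2 (.cons hc .nil),
    fun _ => ⟨_, TimeTerm.addInt_zero _⟩, fun _ _ => rfl, fun _ _ => TimeTerm.addInt_zero _⟩

/-- Lifting lemma for a single resolution step. -/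
theorem Lifts.step {Γ : Set (Rule V)} {P : Atom V} {θ : Subst V} {L L' : List (Atom V)}
    (h : Lifts Γ P θ L) (hstep : GroundStep Γ L L') : Lifts Γ P θ L' := by
  obtain ⟨θs, G, κ, σ, hder, hcomp, hG, hdef, hobj, htime⟩ := h
  obtain ⟨pre', post', r, r', σr, hr, hi, -, rfl, rfl⟩ := hstep
  -- The variant must avoid the goal and the terms of `κ`, so that redefining `σ` affects neither.
  have hF : (conjVars G ∪ ⋃ x ∈ κ.supp ∪ P.vars, κ.varsAt x).Finite :=
    (finite_conjVars G).union
      ((κ.finite_supp.union P.finite_vars).biUnion fun x _ => κ.finite_varsAt x)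
  obtain ⟨C, σ', hren, hdisj, hCi, hσo, hσt⟩ := hi.exists_fresh σ hF
  rw [Set.disjoint_union_left] at hdisj
  obtain ⟨hdG, hdκ⟩ := hdisj
  have hGσ : ∀ a ∈ G, a.subst σ' = a.subst σ := fun a ha => Atom.subst_congr
    (fun i hi => hσo i (Set.disjoint_left.1 hdG ⟨a, ha, hi⟩))
    (fun i hi => hσt i (Set.disjoint_left.1 hdG ⟨a, ha, hi⟩))
  have hκo : ∀ i, Var.obj i ∈ κ.supp ∪ P.vars → (κ.obj i).subst σ' = (κ.obj i).subst σ :=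
    fun i hi => ObjTerm.subst_congr fun j hj =>
      hσo j (Set.disjoint_left.1 hdκ (Set.mem_biUnion hi hj))
  have hκt : ∀ i, Var.time i ∈ κ.supp ∪ P.vars → (κ.time i).subst σ' = (κ.time i).subst σ :=
    fun i hi => TimeTerm.subst_congr fun j hj =>
      hσt j (Set.disjoint_left.1 hdκ (Set.mem_biUnion hi hj))
  have hdef' : ∀ i, ∃ u, (κ.time i).subst σ' = some u := by
    intro i
    by_cases hi : Var.time i ∈ κ.supp
    · rw [hκt i (.inl hi)]
      exact hdef i
    · rw [not_not.1 hi]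
      exact ⟨_, TimeTerm.addInt_zero _⟩
  have hG' : conjSubst σ' G = some (pre' ++ r'.head :: post') := by
    rw [conjSubst_eq_some_iff] at hG ⊢
    refine List.forall₂_iff_get.2 ⟨hG.length_eq, fun i h₁ h₂ => ?_⟩
    rw [hGσ _ (List.get_mem _ _)]
    exact (List.forall₂_iff_get.1 hG).2 i h₁ h₂
  rw [conjSubst_eq_some_iff] at hG'
  obtain ⟨pre, rest, hpre, hrest, rfl⟩ : ∃ pre rest,
      List.Forall₂ (fun a b => a.subst σ' = some b) pre pre' ∧
      List.Forall₂ (fun a b => a.subst σ' = some b) rest (r'.head :: post') ∧ G = pre ++ rest :=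
    ⟨_, _, List.forall₂_take_append _ _ _ hG', List.forall₂_drop_append _ _ _ hG',
      (List.take_append_drop _ _).symm⟩
  obtain ⟨β, post, hβ, hpost, rfl⟩ := List.forall₂_cons_right_iff.1 hrest
  have hunif : IsUnifier σ' C.head β := ⟨r'.head, hCi.2, hβ⟩
  have hdβ : Disjoint C.head.vars β.vars :=
    hdG.symm.mono Set.subset_union_right fun x hx =>
      show ∃ a ∈ pre ++ β :: post, x ∈ a.vars from ⟨β, by simp, hx⟩
  obtain ⟨μ, hμ, hmg, hvars⟩ := exists_mgu hdβ hunif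
  have hμσ : μ.IsComp σ' σ' := hmg σ' hunif
  have hgoal : conjSubst σ' (pre ++ C.body ++ post) = some (pre' ++ r'.body ++ post') :=
    conjSubst_eq_some_iff.2 (List.rel_append
      (List.rel_append hpre (conjSubst_eq_some_iff.1 hCi.1)) hpost)
  obtain ⟨G₁, hG₁, hG₁'⟩ := conjSubst_of_isComp hμσ hgoal
  obtain ⟨κ', hκ'⟩ : ∃ κ', κ.IsComp μ κ' := Subst.exists_isComp fun i => by
    obtain ⟨u, hu⟩ := hdef' i
    exact (TimeTerm.subst_of_isComp hμσ hu).imp fun _ => And.left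
  have hκ'o : ∀ i, (κ'.obj i).subst σ' = (κ.obj i).subst σ' := fun i => by
    rw [← hκ'.1 i, ObjTerm.subst_of_isComp hμσ]
  have hκ't : ∀ i, (κ'.time i).subst σ' = (κ.time i).subst σ' := fun i => by
    obtain ⟨u, hu⟩ := hdef' i
    obtain ⟨s, hs, hsu⟩ := TimeTerm.subst_of_isComp hμσ hu
    rw [hu, ← hsu, ← Option.some.inj (hs.symm.trans (hκ'.2 i))]
  refine ⟨θs ++ [μ], G₁, κ', σ', .snoc hder hr hren
    ⟨hdG, pre, β, post, rfl, ⟨hμ, fun η hη => ⟨η, hmg η hη⟩⟩, hvars, hG₁⟩,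
    .snoc hcomp hκ', hG₁', fun i => ?_, fun i hi => ?_, fun i hi => ?_⟩
  · rw [hκ't]
    exact hdef' i
  · rw [hκ'o, hκo i (.inr hi), hobj i hi]
  · rw [hκ't, hκt i (.inr hi), htime i hi]

theorem Lifts.of_reflTransGen {Γ : Set (Rule V)} {P c : Atom V} {θ : Subst V}
    {L : List (Atom V)} (hc : P.subst θ = some c) (h : ReflTransGen (GroundStep Γ) [c] L) :
    Lifts Γ P θ L := by
  induction h with
  | refl => exact .refl Γ hc
  | tail _ hstep ih => exact ih.step hstep

theorem Atom.IsFuture.of_subst {a b : Atom V} {σ : Subst V} {τ : ℤ} (h : a.subst σ = some b)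
    (hb : b.IsFuture τ) : a.IsFuture τ := by
  cases a with
  | rigid p args =>
    cases h
    exact hb
  | temporal p args t =>
    cases t with
    | point n =>
      cases h
      exact hb
    | add i k => trivial

end TemporalDatalog

open TemporalDatalog in
theorem mainTheorem2 (V : TemporalDatalog.Vocabulary) (Q : TemporalDatalog.Query V)
    (D : Set (TemporalDatalog.Atom V)) (hD : TemporalDatalog.IsDataset Q D) (τ : ℤ)
    (θ : TemporalDatalog.Subst V) (H : Set (TemporalDatalog.Atom V))
    (hθ : TemporalDatalog.IsHypotheticalAnswer Q D τ θ H) :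
    ∃ (ρ σ : TemporalDatalog.Subst V) (G : List (TemporalDatalog.Atom V)),
      TemporalDatalog.IsComputedAnswer Q D τ ρ G ∧
      (∃ κ, ρ.IsComp σ κ ∧ θ = κ.restrict Q.atom.vars) ∧
      ∃ G', TemporalDatalog.conjSubst σ G = some G' ∧ H = {b | b ∈ G'} := by
  obtain ⟨c, L, hc, hcL, hHL⟩ := hθ.exists_groundStep
  obtain ⟨θs, G, κ, σ, hder, hcomp, hG, -, hobj, htime⟩ := Lifts.of_reflTransGen hc hcL
  obtain ⟨-, hsupp, ⟨-, hH, -⟩, -⟩ := hθ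
  obtain ⟨δ, hδ⟩ : ∃ δ, (κ.restrict Q.atom.vars).IsComp σ δ := Subst.exists_isComp fun i => by
    by_cases hi : Var.time i ∈ Q.atom.vars
    · simp only [Subst.restrict, if_pos hi]
      exact ⟨_, htime i hi⟩
    · simp only [Subst.restrict, if_neg hi]
      exact ⟨_, TimeTerm.addInt_zero _⟩
  refine ⟨κ.restrict Q.atom.vars, σ, G, ⟨θs, κ, hder, fun a ha => ?_, hcomp, rfl⟩,
    ⟨δ, hδ, ?_⟩, L, hG, hHL⟩
  · obtain ⟨i, hi, rfl⟩ := List.mem_iff_getElem.1 ha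
    have hall := List.forall₂_iff_get.1 (conjSubst_eq_some_iff.1 hG)
    have hsub := hall.2 i hi (hall.1 ▸ hi)
    obtain ⟨-, hedb, p, args, n, hb, hn⟩ := hH (L.get ⟨i, hall.1 ▸ hi⟩) (by rw [hHL]; simp)
    refine ⟨.of_subst hsub ?_, ?_⟩
    · rw [hb]
      exact hn
    · rw [Atom.pred_subst hsub] at hedb
      exact hedb
  · -- Outside the variables of `P`, both sides are the identity since `supp θ = var P`.
    have ho : θ.obj = (δ.restrict Q.atom.vars).obj := by
      funext i
      by_cases hi : Var.obj i ∈ Q.atom.vars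
      · have := hδ.1 i
        simp only [Subst.restrict, if_pos hi] at this ⊢
        rw [← this, hobj i hi]
      · simp only [Subst.restrict, if_neg hi]
        rw [← hsupp] at hi
        exact not_not.1 hi
    have ht : θ.time = (δ.restrict Q.atom.vars).time := by
      funext i
      by_cases hi : Var.time i ∈ Q.atom.vars
      · have := hδ.2 i
        simp only [Subst.restrict, if_pos hi] at this ⊢
        exact Option.some.inj ((htime i hi).symm.trans this)
      · simp only [Subst.restrict, if_neg hi]
        rw [← hsupp] at hi
        exact not_not.1 hi
    cases θ
    cases ho
    cases ht
    rfl
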